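/- Let $\mathbb{K}$ be $\mathbb{R}$ or $\mathbb{C}$. In this statement, a subspace of a Banach space means a closed, infinite-dimensional linear subspace. An operator $T\colon Y\to X$ between Banach spaces is bounded and linear, and it is an into isomorphism if there is $c>0$ with $\|T(y)\|\ge c\|y\|$ for all $y\in Y$ (equivalently, if it is an isomorphism onto its image). Let $\mathrm{Emb}(Y,X)$ be the set of all into isomorphisms $Y\to X$, with the topology of the operator norm; $S,T\in\mathrm{Emb}(Y,X)$ are homotopic in $\mathrm{Emb}(Y,X)$ if there is a continuous map $[0,1]\to\mathrm{Emb}(Y,X)$, $t\mapsto T_t$, with $T_0=S$ and $T_1=T$. An infinite-dimensional Banach space $X$ is hereditarily indecomposable if no two subspaces $U,V$ of it are in topological direct sum, that is, if for no two subspaces $U,V$ the map $U\times V\to X$, $(u,v)\mapsto u+v$, is an isomorphism onto its image. Theorem. Let $X$ be a hereditarily indecomposable Banach space over $\mathbb{K}$, and let $Y$ and $Z$ be subspaces of $X$ that are isomorphic (that is, there is a linear homeomorphism $Y\to Z$). Then there is an into isomorphism $T\colon Y\to X$ with $T(Y)=Z$ that is homotopic in $\mathrm{Emb}(Y,X)$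 to the inclusion map $Y\hookrightarrow X$. -/

import Mathlib

namespace BanachHI

/-- The bounded operator `T : E → F` is an into isomorphism: it is bounded below. -/
def IsIntoIso {𝕜 : Type*} [RCLike 𝕜] {E : Type*} [NormedAddCommGroup E] [NormedSpace 𝕜 E]
    {F : Type*} [NormedAddCommGroup F] [NormedSpace 𝕜 F] (T : E →L[𝕜] F) : Prop :=
  ∃ c : ℝ, 0 < c ∧ ∀ x : E, c * ‖x‖ ≤ ‖T x‖

/-- The set `Emb(E, F)` of into isomorphisms, a subset of the space of bounded operators
with the operator norm. -/
def Emb (𝕜 : Type*) [RCLike 𝕜] (E : Type*) [NormedAddCommGroup E] [NormedSpace 𝕜 E]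
    (F : Type*) [NormedAddCommGroup F] [NormedSpace 𝕜 F] : Set (E →L[𝕜] F) :=
  {T | IsIntoIso T}

/-- `S` and `T` are homotopic in `Emb(E, F)`: a norm-continuous path of into isomorphisms,
parametrized by `[0, 1]`, goes from `S` to `T`. -/
def Homotopic {𝕜 : Type*} [RCLike 𝕜] {E : Type*} [NormedAddCommGroup E] [NormedSpace 𝕜 E]
    {F : Type*} [NormedAddCommGroup F] [NormedSpace 𝕜 F] (S T : E →L[𝕜] F) : Prop :=
  JoinedIn (Emb 𝕜 E F) S T

/-- A subspace in the sense of Banach space theory: closed and infinite-dimensional. -/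
def IsSubspace {𝕜 : Type*} [RCLike 𝕜] {E : Type*} [NormedAddCommGroup E] [NormedSpace 𝕜 E]
    (U : Submodule 𝕜 E) : Prop :=
  IsClosed (U : Set E) ∧ ¬ FiniteDimensional 𝕜 U

/-- `U` and `V` are in topological direct sum: the map `U × V → E`, `(u, v) ↦ u + v`, is an
isomorphism onto its image. -/
def InTopologicalDirectSum {𝕜 : Type*} [RCLike 𝕜] {E : Type*} [NormedAddCommGroup E]
    [NormedSpace 𝕜 E] (U V : Submodule 𝕜 E) : Prop :=
  IsIntoIso (U.subtypeL.coprod V.subtypeL)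

/-- The infinite-dimensional space `E` is hereditarily indecomposable: no two closed
infinite-dimensional subspaces of it are in topological direct sum. -/
def IsHI (𝕜 : Type*) [RCLike 𝕜] (E : Type*) [NormedAddCommGroup E] [NormedSpace 𝕜 E] : Prop :=
  ¬ FiniteDimensional 𝕜 E ∧
    ∀ U V : Submodule 𝕜 E, IsSubspace U → IsSubspace V → ¬ InTopologicalDirectSum U V

end BanachHI

namespace BanachHI

open Topology

universe u v

/-! ### Into isomorphisms: stability and recognition. -/

section Banach

variable {𝕜 : Type*} [RCLike 𝕜] {E : Type*} [NormedAddCommGroup E] [NormedSpace 𝕜 E]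
  {F : Type*} [NormedAddCommGroup F] [NormedSpace 𝕜 F]

/-! Let `S` be the inclusion of `Y` and `φ` an isomorphism onto `Z`, seen as a map into `X`. The
segment from `S` to `φ` may leave `Emb`, but hereditary indecomposability limits how badly. An
operator that is not upper semi-Fredholm is nearly zero on some subspace
(`exists_isSubspace_norm_le`). If `A` and `B` are two such operators, their subspaces contain nearly
equal vectors, so no combination of `A` and `B` is an into isomorphism. If the segments from `S` to
`φ` and to `-φ` both contained such operators, a combination of them would be a nonzero multiple of
`S`. Hence one of the segments is upper semi-Fredholm throughout
(`IsHI.isUpperSemiFredholm_segment`), and `φ` and `-φ` have the same image.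

Along such a segment the sign of the index is constant. If it is negative, every operator has finite
rank perturbations that are into isomorphisms and not onto, and any two of these are homotopic
(`homotopic_of_hasFiniteRange`), so connectedness of `[0, 1]` joins the ends
(`homotopic_of_isUpperSemiFredholm`). Otherwise both ends are onto, so `Z` is `X`, which is also the
image of the inclusion. -/

theorem IsIntoIso.injective {T : E →L[𝕜] F} (hT : IsIntoIso T) : Function.Injective T := by
  obtain ⟨c, hc, h⟩ := hT
  refine (injective_iff_map_eq_zero T).2 fun x hx ↦ ?_
  have := h x
  rw [hx, norm_zero] at this
  exact norm_le_zero_iff.1 (nonpos_of_mul_nonpos_right this hc)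

theorem isOpen_emb : IsOpen (Emb 𝕜 E F) := by
  refine Metric.isOpen_iff.2 fun T ⟨c, hc, h⟩ ↦ ⟨c / 2, half_pos hc, fun S hS ↦ ⟨c / 2, half_pos hc,
    fun x ↦ ?_⟩⟩
  rw [Metric.mem_ball, dist_comm, dist_eq_norm] at hS
  have h1 : ‖T x - S x‖ ≤ c / 2 * ‖x‖ :=
    ((T - S).le_opNorm x).trans (mul_le_mul_of_nonneg_right hS.le (norm_nonneg _))
  have h2 := norm_le_norm_add_norm_sub (S x) (T x)
  rw [norm_sub_rev] at h2
  linarith [h x]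

theorem isIntoIso_of_antilipschitz {T : E →L[𝕜] F} {K : NNReal} (h : AntilipschitzWith K T) :
    IsIntoIso T := by
  refine ⟨((K : ℝ) + 1)⁻¹, by positivity, fun x ↦ ?_⟩
  have := h.le_mul_dist x 0
  rw [map_zero, dist_zero_right, dist_zero_right] at this
  rw [inv_mul_le_iff₀ (by positivity)]
  linarith [norm_nonneg (T x)]

/-- An injective operator that is bounded below on a closed subspace of finite codimension is
an into isomorphism. -/
theorem isIntoIso_of_injective [CompleteSpace E] [CompleteSpace F] {W : Type*}
    [NormedAddCommGroup W] [NormedSpace 𝕜 W] [FiniteDimensional 𝕜 W] {T : E →L[𝕜] F}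
    (hT : Function.Injective T) (f : E →L[𝕜] W) {c : ℝ} (hc : 0 < c)
    (h : ∀ x, f x = 0 → c * ‖x‖ ≤ ‖T x‖) : IsIntoIso T := by
  have hcofg : (LinearMap.ker (f : E →ₗ[𝕜] W)).CoFG :=
    LinearMap.ker_coFG_iff_hasFiniteRange.2 (by simp)
  have hanti : AntilipschitzWith (Real.toNNReal c⁻¹)
      (T ∘L (LinearMap.ker (f : E →ₗ[𝕜] W)).subtypeL) := by
    refine ContinuousLinearMap.antilipschitz_of_bound _ fun x ↦ ?_
    rw [Real.coe_toNNReal _ (inv_nonneg.2 hc.le), ← div_eq_inv_mul, le_div_iff₀ hc, mul_comm]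
    exact h x x.2
  have : CompleteSpace (LinearMap.ker (f : E →ₗ[𝕜] W)) := f.isClosed_ker.completeSpace_coe
  have hcl := hanti.isClosed_range (ContinuousLinearMap.uniformContinuous _)
  have hcl2 : IsClosed ((LinearMap.ker (f : E →ₗ[𝕜] W)).map (T : E →ₗ[𝕜] F) : Set F) := by
    convert hcl
    ext y
    simp
  have hcl3 := LinearMap.isClosed_range_of_isClosed_map_of_finiteDimensional_quotient hcl2
  obtain ⟨K, hK⟩ := T.antilipschitz_of_injective_of_isClosed_range hT
    (by simpa [LinearMap.coe_range] using hcl3)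
  exact isIntoIso_of_antilipschitz hK

theorem isIntoIso_of_injective_of_hasFiniteRange [CompleteSpace E] [CompleteSpace F]
    {S T : E →L[𝕜] F} (hS : IsIntoIso S) (hT : Function.Injective T)
    (h : ((T - S : E →L[𝕜] F) : E →ₗ[𝕜] F).HasFiniteRange) : IsIntoIso T := by
  obtain ⟨c, hc, hS⟩ := hS
  have : FiniteDimensional 𝕜 (LinearMap.range ((T - S : E →L[𝕜] F) : E →ₗ[𝕜] F)) :=
    Module.Finite.iff_fg.2 (LinearMap.hasFiniteRange_iff_range.1 h)
  refine isIntoIso_of_injective hT (T - S).rangeRestrict hc fun x hx ↦ ?_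
  have hx' : T x = S x := sub_eq_zero.1 (congrArg Subtype.val hx)
  exact hx' ▸ hS x

/-! ### Homotopies between finite rank perturbations. -/

/-- A finite rank perturbation of a surjective linear map is surjective when it is injective. -/
theorem surjective_of_injective_of_hasFiniteRange {V V' : Type*} [AddCommGroup V] [Module 𝕜 V]
    [AddCommGroup V'] [Module 𝕜 V'] {S T : V →ₗ[𝕜] V'} (hS : Function.Surjective S)
    (hT : Function.Injective T) (h : (T - S).HasFiniteRange) : Function.Surjective T := by
  -- `S` and `T` agree on `K`, which has finite codimension, so both induce maps from `V ⧸ K` to `V'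
  -- ⧸ R`. One is onto and the other injective, so the dimensions agree.
  set K := LinearMap.ker (T - S) with hK
  have hmap : ∀ x ∈ K, T x = S x := fun x hx ↦ sub_eq_zero.1 hx
  have hfin : FiniteDimensional 𝕜 (V ⧸ K) := LinearMap.ker_coFG_iff_hasFiniteRange.2 h
  set R := K.map T
  let S' : V ⧸ K →ₗ[𝕜] V' ⧸ R := K.mapQ R S fun x hx ↦ ⟨x, hx, hmap x hx⟩
  let T' : V ⧸ K →ₗ[𝕜] V' ⧸ R := K.mapQ R T fun x hx ↦ ⟨x, hx, rfl⟩
  have hS' : Function.Surjective S' := fun q ↦ by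
    obtain ⟨y, rfl⟩ := R.mkQ_surjective q
    obtain ⟨x, rfl⟩ := hS y
    exact ⟨K.mkQ x, rfl⟩
  have hT' : Function.Injective T' := by
    refine (injective_iff_map_eq_zero T').2 fun q hq ↦ ?_
    obtain ⟨x, rfl⟩ := K.mkQ_surjective q
    obtain ⟨z, hz, hzx⟩ := (Submodule.Quotient.mk_eq_zero R).1 hq
    exact (Submodule.Quotient.mk_eq_zero K).2 (hT hzx ▸ hz)
  have hfin' : FiniteDimensional 𝕜 (V' ⧸ R) := Module.Finite.of_surjective S' hS'
  have hsurj : Function.Surjective T' :=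
    (LinearMap.injective_iff_surjective_of_finrank_eq_finrank
      (le_antisymm (LinearMap.finrank_le_finrank_of_injective hT')
        (LinearMap.finrank_le_finrank_of_surjective hS'))).1 hT'
  intro y
  obtain ⟨q, hq⟩ := hsurj (R.mkQ y)
  obtain ⟨x, rfl⟩ := K.mkQ_surjective q
  obtain ⟨z, -, hz⟩ := (Submodule.Quotient.eq R).1 hq
  exact ⟨x - z, by rw [map_sub, hz, sub_sub_cancel]⟩

/-- The complement of a subspace of codimension at least two over `ℝ` or `ℂ` is path connected. -/
theorem isPathConnected_compl_of_linearIndependent_mkQ {R : Submodule 𝕜 F} {a b : F}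
    (h : LinearIndependent 𝕜 ![R.mkQ a, R.mkQ b]) : IsPathConnected ((R : Set F)ᶜ) := by
  let : NormedSpace ℝ F := NormedSpace.restrictScalars ℝ 𝕜 F
  have : IsScalarTower ℝ 𝕜 F := .restrictScalars ℝ 𝕜 F
  refine isPathConnected_compl_of_one_lt_codim (E := R.restrictScalars ℝ) ?_
  have hli : LinearIndependent ℝ
      ![(R.restrictScalars ℝ).mkQ a, (R.restrictScalars ℝ).mkQ b] := by
    refine LinearIndependent.pair_iff.2 fun s t hst ↦ ?_
    have hmem : s • a + t • b ∈ R := by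
      refine (Submodule.Quotient.mk_eq_zero (R.restrictScalars ℝ)).1 ?_
      exact hst
    have hst' : (s : 𝕜) • R.mkQ a + (t : 𝕜) • R.mkQ b = 0 := by
      rw [← map_smul, ← map_smul, ← map_add]
      refine (Submodule.Quotient.mk_eq_zero R).2 ?_
      rwa [← algebraMap_smul 𝕜 s a, ← algebraMap_smul 𝕜 t b] at hmem
    simpa using LinearIndependent.pair_iff.1 h _ _ hst'
  have := hli.cardinal_lift_le_rank
  rw [Cardinal.mk_fin, Cardinal.lift_natCast, Cardinal.lift_id'] at this
  exact lt_of_lt_of_le (by norm_num) this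

theorem hasFiniteRange_smulRight (f : E →L[𝕜] 𝕜) (w : F) :
    ((f.smulRight w : E →L[𝕜] F) : E →ₗ[𝕜] F).HasFiniteRange := by
  have : ((f.smulRight w : E →L[𝕜] F) : E →ₗ[𝕜] F)
      = (LinearMap.toSpanSingleton 𝕜 F w) ∘ₗ (f : E →ₗ[𝕜] 𝕜) := by
    ext x; simp
  rw [this]
  exact LinearMap.HasFiniteRange.comp_left (by simp) _

/-- Moving the value of an into isomorphism at a single vector `e`, off the image of a hyperplane
complementing `e`, gives an into isomorphism that is homotopic to it, provided that it is not
onto. -/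
theorem homotopic_add_smulRight [CompleteSpace E] [CompleteSpace F] {T : E →L[𝕜] F}
    (hT : IsIntoIso T) (hT' : ¬ Function.Surjective T) {f : E →L[𝕜] 𝕜} {e : E} (he : f e = 1)
    {w : F} (hw : ∀ x, f x = 0 → T x ≠ w) : Homotopic T (T + f.smulRight (w - T e)) := by
  set R := (LinearMap.ker (f : E →ₗ[𝕜] 𝕜)).map (T : E →ₗ[𝕜] F) with hR
  have hRmem : ∀ y, y ∉ R ↔ ∀ x, f x = 0 → T x ≠ y := fun y ↦ by simp [R]
  have hTe : T e ∉ R := (hRmem _).2 fun x hx hxe ↦ by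
    rw [hT.injective hxe, he] at hx
    exact one_ne_zero hx
  obtain ⟨z, hz⟩ := not_forall.1 hT'
  -- The vector `z` outside the image provides the second dimension: over `ℝ`, the complement of a
  -- hyperplane is disconnected.
  have hli : LinearIndependent 𝕜 ![R.mkQ (T e), R.mkQ z] := by
    refine LinearIndependent.pair_iff.2 fun s t hst ↦ ?_
    rw [← map_smul R.mkQ, ← map_smul R.mkQ, ← map_add] at hst
    have hst : s • T e + t • z ∈ R := (Submodule.Quotient.mk_eq_zero R).1 hst
    obtain ⟨x, hx, hx'⟩ := hst
    have hx' : T x = s • T e + t • z := hx'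
    have ht : t = 0 := by
      by_contra ht
      refine hz ⟨t⁻¹ • (x - s • e), ?_⟩
      rw [map_smul, map_sub, map_smul, hx', add_sub_cancel_left, inv_smul_smul₀ ht]
    refine ⟨?_, ht⟩
    rw [ht, zero_smul, add_zero, ← map_smul] at hx'
    have := hT.injective hx'
    rw [this] at hx
    simpa [he] using hx
  have hpath := (isPathConnected_compl_of_linearIndependent_mkQ hli).joinedIn _ hTe w
    ((hRmem w).2 hw)
  let g : F → (E →L[𝕜] F) := fun v ↦ T + f.smulRight (v - T e)
  have hg : Continuous g := by
    have : g = fun v ↦ T + ContinuousLinearMap.smulRightL 𝕜 E F f (v - T e) := by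
      ext; rfl
    rw [this]
    fun_prop
  have hemb : ∀ v, v ∉ R → g v ∈ Emb 𝕜 E F := fun v hv ↦ by
    refine isIntoIso_of_injective_of_hasFiniteRange hT ?_ ?_
    · refine (injective_iff_map_eq_zero _).2 fun x hx ↦ ?_
      have hx' : T (x - f x • e) + f x • v = 0 := by
        simp only [g, add_apply, ContinuousLinearMap.smulRight_apply] at hx
        rw [← hx, map_sub, map_smul, smul_sub]
        abel
      have hker : f (x - f x • e) = 0 := by simp [he]
      have hfx : f x = 0 := by
        by_contra hfx
        refine (hRmem v).1 hv (-(f x)⁻¹ • (x - f x • e)) (by simp [he]) ?_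
        rw [map_smul, eq_neg_of_add_eq_zero_left hx', smul_neg, neg_smul, neg_neg,
          inv_smul_smul₀ hfx]
      rw [hfx, zero_smul, zero_smul, sub_zero, add_zero] at hx'
      exact hT.injective (hx'.trans (map_zero T).symm)
    · simpa [g] using hasFiniteRange_smulRight f (v - T e)
  have hmap := hpath.map_continuousOn (f := g) hg.continuousOn
  have h0 : g (T e) = T := by ext; simp [g]
  rw [h0] at hmap
  refine hmap.mono ?_
  rintro _ ⟨v, hv, rfl⟩
  exact hemb v hv

theorem not_surjective_of_hasFiniteRange {S T : E →L[𝕜] F} (hS : Function.Injective S)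
    (hS' : ¬ Function.Surjective S)
    (h : ((T - S : E →L[𝕜] F) : E →ₗ[𝕜] F).HasFiniteRange) : ¬ Function.Surjective T := by
  refine fun hT ↦ hS' (surjective_of_injective_of_hasFiniteRange (S := (T : E →ₗ[𝕜] F))
    (T := (S : E →ₗ[𝕜] F)) hT hS ?_)
  rw [← neg_sub]
  exact h.neg

/-- Two into isomorphisms that are not onto and differ by an operator of finite rank are
homotopic. -/
theorem homotopic_of_hasFiniteRange [CompleteSpace E] [CompleteSpace F] {S T : E →L[𝕜] F}
    (hS : IsIntoIso S) (hS' : ¬ Function.Surjective S) (hT : IsIntoIso T)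
    (h : ((T - S : E →L[𝕜] F) : E →ₗ[𝕜] F).HasFiniteRange) : Homotopic S T := by
  induction hn : Module.finrank 𝕜 (LinearMap.range ((T - S : E →L[𝕜] F) : E →ₗ[𝕜] F))
    using Nat.strong_induction_on generalizing S with
  | _ n ih =>
    by_cases hG : T = S
    · exact hG ▸ JoinedIn.refl hT
    obtain ⟨e, he⟩ : ∃ e, (T - S) e ≠ 0 := by
      by_contra! h0
      exact hG (sub_eq_zero.1 (ContinuousLinearMap.ext h0))
    -- `y` is the only possible preimage of `T e` under `S`; a functional nonzero at `y` keeps `T e`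
    -- off the image of its kernel.
    obtain ⟨y, hy, hy'⟩ : ∃ y, (T - S) y ≠ 0 ∧ ∀ x, S x = T e → x = y := by
      by_cases hw : ∃ y, S y = T e
      · obtain ⟨y, hy⟩ := hw
        refine ⟨y, fun h0 ↦ he ?_, fun x hx ↦ hS.injective (hx.trans hy.symm)⟩
        have h1 : T y = T e := (sub_eq_zero.1 h0).trans hy
        rw [← hT.injective h1]
        exact h0
      · exact ⟨e, he, fun x hx ↦ (hw ⟨x, hx⟩).elim⟩
    obtain ⟨g, hge, hgy⟩ := SeparatingDual.exists_eq_one_ne_zero_of_ne_zero_pair (R := 𝕜) he hy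
    -- Since `f` factors through `T - S`, correcting `S` at `e` puts the range of the new difference
    -- inside `ker g`, which misses `(T - S) e`; the rank drops.
    set f : E →L[𝕜] 𝕜 := g ∘L (T - S) with hf
    have hstep := homotopic_add_smulRight (f := f) (e := e) (w := T e) hS hS' hge
      fun x hx hx' ↦ hgy (by rw [← hy' x hx']; exact hx)
    set S₁ := S + f.smulRight (T e - S e) with hS₁
    have hfr : ((S₁ - S : E →L[𝕜] F) : E →ₗ[𝕜] F).HasFiniteRange := by
      simpa [hS₁] using hasFiniteRange_smulRight f (T e - S e)
    have hfr' : ((T - S₁ : E →L[𝕜] F) : E →ₗ[𝕜] F).HasFiniteRange := by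
      have := h.sub hfr
      rwa [← ContinuousLinearMap.toLinearMap_sub, sub_sub_sub_cancel_right] at this
    have hfd : FiniteDimensional 𝕜 (LinearMap.range ((T - S : E →L[𝕜] F) : E →ₗ[𝕜] F)) :=
      Module.Finite.iff_fg.2 (LinearMap.hasFiniteRange_iff_range.1 h)
    have hcomp : ∀ x, (T - S₁) x = (T - S) (x - f x • e) := fun x ↦ by
      simp only [hS₁, sub_apply, add_apply,
        ContinuousLinearMap.smulRight_apply, map_sub, map_smul, smul_sub]
      abel
    have hlt : LinearMap.range ((T - S₁ : E →L[𝕜] F) : E →ₗ[𝕜] F) <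
        LinearMap.range ((T - S : E →L[𝕜] F) : E →ₗ[𝕜] F) := by
      refine lt_of_le_of_ne ?_ fun heq ↦ ?_
      · rintro _ ⟨x, rfl⟩
        exact ⟨_, (hcomp x).symm⟩
      · have : (T - S) e ∈ LinearMap.range ((T - S₁ : E →L[𝕜] F) : E →ₗ[𝕜] F) :=
          heq ▸ ⟨e, rfl⟩
        obtain ⟨x, hx⟩ := this
        have hx : (T - S₁) x = (T - S) e := hx
        have : g ((T - S₁) x) = 0 := by
          rw [hcomp]
          change f (x - f x • e) = 0
          rw [map_sub, map_smul, show f e = 1 from hge, smul_eq_mul, mul_one, sub_self]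
        rw [hx, hge] at this
        exact one_ne_zero this
    have hemb : IsIntoIso S₁ := hstep.target_mem
    exact hstep.trans (ih _ (hn ▸ Submodule.finrank_lt_finrank_of_lt hlt) hemb
      (not_surjective_of_hasFiniteRange hS.injective hS' hfr) hfr' rfl)

/-! ### The sign of the index. -/

/-- Over a field, two vector spaces are comparable: there is an injective but not surjective map
from the first to the second, or a surjective one. -/
theorem exists_injective_not_surjective_or_surjective (K : Type*) [Field K]
    (V : Type u) (W : Type v) [AddCommGroup V] [Module K V] [AddCommGroup W] [Module K W] :
    ∃ L : V →ₗ[K] W, (Function.Injective L ∧ ¬ Function.Surjective L) ∨ Function.Surjective L := by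
  rcases le_total (Cardinal.lift.{v} (Module.rank K V)) (Cardinal.lift.{u} (Module.rank K W))
    with h | h
  · obtain ⟨L, hL⟩ := lift_rank_le_iff_exists_linearMap.1 h
    by_cases hs : Function.Surjective L
    · exact ⟨L, .inr hs⟩
    · exact ⟨L, .inl ⟨hL, hs⟩⟩
  · obtain ⟨L, hL⟩ := lift_rank_le_iff_exists_linearMap.1 h
    obtain ⟨L', hL'⟩ := L.exists_leftInverse_of_injective (LinearMap.ker_eq_bot.2 hL)
    exact ⟨L', .inr fun w ↦ ⟨L w, LinearMap.congr_fun hL' w⟩⟩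

/-- The operator `A` is bounded below on a closed subspace of finite codimension. -/
def IsUpperSemiFredholm (A : E →L[𝕜] F) : Prop :=
  ∃ (s : Finset (StrongDual 𝕜 E)) (c : ℝ), 0 < c ∧
    ∀ x, (∀ f ∈ s, f x = 0) → c * ‖x‖ ≤ ‖A x‖

/-- Some finite rank perturbation of `A` is an into isomorphism that is not onto. -/
def HasNegativeIndex (A : E →L[𝕜] F) : Prop :=
  ∃ T : E →L[𝕜] F, ((T - A : E →L[𝕜] F) : E →ₗ[𝕜] F).HasFiniteRange ∧ IsIntoIso T ∧
    ¬ Function.Surjective T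

/-- Some finite rank perturbation of `A` is onto. -/
def HasNonnegativeIndex (A : E →L[𝕜] F) : Prop :=
  ∃ T : E →L[𝕜] F, ((T - A : E →L[𝕜] F) : E →ₗ[𝕜] F).HasFiniteRange ∧ Function.Surjective T

theorem HasNegativeIndex.not_hasNonnegativeIndex {A : E →L[𝕜] F} (h : HasNegativeIndex A) :
    ¬ HasNonnegativeIndex A := by
  rintro ⟨S, hS, hS'⟩
  obtain ⟨T, hT, hT', hT''⟩ := h
  refine not_surjective_of_hasFiniteRange hT'.injective hT'' ?_ hS'
  have := hS.sub hT
  rwa [← ContinuousLinearMap.toLinearMap_sub, sub_sub_sub_cancel_right] at this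

/-- Keep `A` on the kernel of `f` and redefine it on the finite-dimensional complement `g(W)`, `W`
the range of `f₀`, by lifting a linear map `L` from `W` to `F ⧸ R`. Comparing the dimensions of
these two spaces decides the sign. -/
theorem IsUpperSemiFredholm.hasNegativeIndex_or_hasNonnegativeIndex [CompleteSpace E]
    [CompleteSpace F] {A : E →L[𝕜] F} (hA : IsUpperSemiFredholm A) :
    HasNegativeIndex A ∨ HasNonnegativeIndex A := by
  obtain ⟨s, c, hc, h⟩ := hA
  let f₀ : E →L[𝕜] (s → 𝕜) := ContinuousLinearMap.pi fun i ↦ i.1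
  let f := f₀.rangeRestrict
  have hf : ∀ x, f x = 0 → c * ‖x‖ ≤ ‖A x‖ := fun x hx ↦ h x fun g hg ↦
    congrFun (congrArg Subtype.val hx : f₀ x = 0) ⟨g, hg⟩
  obtain ⟨g, hg⟩ := ContinuousLinearMap.exists_rightInverse_of_surjective f
    (by simp [f])
  have hg : ∀ w, f (g w) = w := fun w ↦ DFunLike.congr_fun hg w
  set R := (LinearMap.ker f.toLinearMap).map (A : E →ₗ[𝕜] F) with hR
  obtain ⟨L, hL⟩ := exists_injective_not_surjective_or_surjective 𝕜
    (LinearMap.range (f₀ : E →ₗ[𝕜] (s → 𝕜))) (F ⧸ R)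
  obtain ⟨r, hr⟩ := R.mkQ.exists_rightInverse_of_surjective (by simp)
  let L' := LinearMap.toContinuousLinearMap (r ∘ₗ L)
  have hL' : ∀ w, R.mkQ (L' w) = L w := fun w ↦ LinearMap.congr_fun hr (L w)
  let T : E →L[𝕜] F := A + (L' - A ∘L g) ∘L f
  have hTfr : ((T - A : E →L[𝕜] F) : E →ₗ[𝕜] F).HasFiniteRange := by
    have : T - A = (L' - A ∘L g) ∘L f := by simp [T]
    rw [this]
    exact LinearMap.HasFiniteRange.comp_left (u := f.toLinearMap) (by simp)
      (L' - A ∘L g).toLinearMap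
  have hTx : ∀ x, T x = A (x - g (f x)) + L' (f x) := fun x ↦ by
    simp only [T, add_apply, sub_apply, ContinuousLinearMap.comp_apply, map_sub]
    abel
  have hmem : ∀ x, A (x - g (f x)) ∈ R := fun x ↦ ⟨_, by simp [hg], rfl⟩
  have hTmk : ∀ x, R.mkQ (T x) = L (f x) := fun x ↦ by
    have h0 : R.mkQ (A (x - g (f x))) = 0 := (Submodule.Quotient.mk_eq_zero R).2 (hmem x)
    rw [hTx, map_add, hL', h0, zero_add]
  have hTker : ∀ x, f x = 0 → T x = A x := fun x hx ↦ by simp [hTx, hx]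
  have hfsurj : Function.Surjective f := fun w ↦ ⟨g w, hg w⟩
  rcases hL with ⟨hinj, hns⟩ | hsurj
  · refine .inl ⟨T, hTfr, ?_, fun hT ↦ hns fun q ↦ ?_⟩
    · refine isIntoIso_of_injective ?_ f hc fun x hx ↦ (hTker x hx).symm ▸ hf x hx
      refine (injective_iff_map_eq_zero T).2 fun x hx ↦ ?_
      have hfx : f x = 0 := hinj (by rw [← hTmk, hx, map_zero, map_zero])
      have := hf x hfx
      rw [← hTker x hfx, hx, norm_zero] at this
      exact norm_le_zero_iff.1 (nonpos_of_mul_nonpos_right this hc)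
    · obtain ⟨y, rfl⟩ := R.mkQ_surjective q
      obtain ⟨x, rfl⟩ := hT y
      exact ⟨f x, (hTmk x).symm⟩
  · refine .inr ⟨T, hTfr, fun y ↦ ?_⟩
    obtain ⟨w, hw⟩ := hsurj (R.mkQ y)
    obtain ⟨x, rfl⟩ := hfsurj w
    obtain ⟨z, hz, hz'⟩ := (Submodule.Quotient.eq R).1 (hw.symm.trans (hTmk x).symm)
    have hz' : A z = y - T x := hz'
    exact ⟨x + z, by rw [map_add, hTker z hz, hz', add_sub_cancel]⟩

theorem isOpen_setOf_surjective [CompleteSpace E] [CompleteSpace F] :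
    IsOpen {T : E →L[𝕜] F | Function.Surjective T} := by
  refine Metric.isOpen_iff.2 fun T hT ↦ ?_
  have hT : LinearMap.range (T : E →ₗ[𝕜] F) = ⊤ := LinearMap.range_eq_top.2 hT
  let N := T.nonlinearRightInverseOfSurjective hT
  have hN : 0 < N.nnnorm := T.nonlinearRightInverseOfSurjective_nnnorm_pos hT
  refine ⟨(N.nnnorm : ℝ)⁻¹, by positivity, fun S hS ↦ ?_⟩
  rw [Metric.mem_ball, dist_eq_norm] at hS
  have happ : ApproximatesLinearOn S T Set.univ ‖S - T‖₊ := fun x _ y _ ↦ by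
    rw [← map_sub, ← sub_apply]
    exact (S - T).le_opNorm _
  have hlt : ‖S - T‖₊ < N.nnnorm⁻¹ := by
    rw [← NNReal.coe_lt_coe, coe_nnnorm, NNReal.coe_inv]
    exact hS
  have hopen := happ.open_image N isOpen_univ (.inr hlt)
  rw [Set.image_univ] at hopen
  have htop : LinearMap.range (S : E →ₗ[𝕜] F) = ⊤ :=
    Submodule.eq_top_of_nonempty_interior' _ ⟨0, by
      rw [LinearMap.coe_range]
      erw [hopen.interior_eq]
      exact ⟨0, map_zero S⟩⟩
  exact LinearMap.range_eq_top.1 htop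

/-- If `z` is outside the image of `T`, then `(x, c) ↦ T x + c • z` is again an into isomorphism.
This survives small changes of `T` and keeps `z` outside the image. -/
theorem isOpen_setOf_isIntoIso_not_surjective [CompleteSpace E] [CompleteSpace F] :
    IsOpen {T : E →L[𝕜] F | IsIntoIso T ∧ ¬ Function.Surjective T} := by
  refine isOpen_iff_mem_nhds.2 fun T ⟨hT, hT'⟩ ↦ ?_
  obtain ⟨z, hz⟩ := not_forall.1 hT'
  let g : (E →L[𝕜] F) → (E × 𝕜 →L[𝕜] F) := fun S ↦
    S.comp (ContinuousLinearMap.fst 𝕜 E 𝕜) + (ContinuousLinearMap.snd 𝕜 E 𝕜).smulRight z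
  have hg : Continuous g := by fun_prop
  have hgx : ∀ S p, g S p = S p.1 + p.2 • z := fun S p ↦ rfl
  have hgT : g T ∈ Emb 𝕜 (E × 𝕜) F := by
    obtain ⟨c, hc, hcT⟩ := hT
    refine isIntoIso_of_injective ?_ (ContinuousLinearMap.snd 𝕜 E 𝕜) hc fun p hp ↦ ?_
    · refine (injective_iff_map_eq_zero _).2 fun p hp ↦ ?_
      rw [hgx] at hp
      have hp2 : p.2 = 0 := by
        by_contra h0
        refine hz ⟨-p.2⁻¹ • p.1, ?_⟩
        rw [map_smul, eq_neg_of_add_eq_zero_left hp, smul_neg, neg_smul, neg_neg,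
          inv_smul_smul₀ h0]
      rw [hp2, zero_smul, add_zero] at hp
      exact Prod.ext (IsIntoIso.injective ⟨c, hc, hcT⟩ (hp.trans (map_zero T).symm)) hp2
    · have hp : p.2 = 0 := hp
      have hn : ‖p‖ = ‖p.1‖ := by simp [Prod.norm_def, hp]
      rw [hgx, hp, zero_smul, add_zero, hn]
      exact hcT p.1
  filter_upwards [isOpen_emb.mem_nhds hT, (isOpen_emb.preimage hg).mem_nhds hgT] with S hS hgS
  refine ⟨hS, fun hsurj ↦ ?_⟩
  obtain ⟨x, hx⟩ := hsurj z
  have : ((x, -1) : E × 𝕜) = 0 := IsIntoIso.injective hgS (by simp [hgx, hx])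
  simpa using congrArg Prod.snd this

theorem isOpen_setOf_exists_hasFiniteRange {U : Set (E →L[𝕜] F)} (hU : IsOpen U) :
    IsOpen {A : E →L[𝕜] F |
      ∃ T : E →L[𝕜] F, ((T - A : E →L[𝕜] F) : E →ₗ[𝕜] F).HasFiniteRange ∧ T ∈ U} := by
  refine isOpen_iff_mem_nhds.2 fun A ⟨T, hT, hTU⟩ ↦ ?_
  have hcont : Continuous fun B : E →L[𝕜] F ↦ B + (T - A) := by fun_prop
  filter_upwards [(hU.preimage hcont).mem_nhds (by simpa using hTU)] with B hB
  exact ⟨B + (T - A), by rwa [add_sub_cancel_left], hB⟩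

/-! ### Paths of upper semi-Fredholm operators. -/

/-- A path of upper semi-Fredholm operators between two into isomorphisms can be replaced by
a path of into isomorphisms, unless both of its ends are onto. -/
theorem homotopic_of_isUpperSemiFredholm [CompleteSpace E] [CompleteSpace F]
    {γ : unitInterval → (E →L[𝕜] F)} (hγ : Continuous γ) (h : ∀ t, IsUpperSemiFredholm (γ t))
    (h0 : IsIntoIso (γ 0)) (h1 : IsIntoIso (γ 1)) :
    (Function.Surjective (γ 0) ∧ Function.Surjective (γ 1)) ∨ Homotopic (γ 0) (γ 1) := by
  have hfr0 : ∀ A : E →L[𝕜] F, ((A - A : E →L[𝕜] F) : E →ₗ[𝕜] F).HasFiniteRange := fun A ↦ by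
    rw [sub_self]
    exact LinearMap.HasFiniteRange.zero
  have hneg : IsOpen {t | HasNegativeIndex (γ t)} :=
    (isOpen_setOf_exists_hasFiniteRange isOpen_setOf_isIntoIso_not_surjective).preimage hγ
  have hnonneg : IsOpen {t | HasNonnegativeIndex (γ t)} :=
    (isOpen_setOf_exists_hasFiniteRange isOpen_setOf_surjective).preimage hγ
  have hor := fun t ↦ (h t).hasNegativeIndex_or_hasNonnegativeIndex
  rcases isPreconnected_univ.subset_or_subset hneg hnonneg
    (Set.disjoint_left.2 fun t ht ↦ ht.not_hasNonnegativeIndex) (fun t _ ↦ hor t) with hall | hall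
  · right
    have hns : ∀ t (T : E →L[𝕜] F), ((T - γ t : E →L[𝕜] F) : E →ₗ[𝕜] F).HasFiniteRange →
        ¬ Function.Surjective T := fun t T hT hT' ↦
      HasNegativeIndex.not_hasNonnegativeIndex (hall (Set.mem_univ t)) ⟨T, hT, hT'⟩
    have hjoin : ∀ t (S T : E →L[𝕜] F), ((S - γ t : E →L[𝕜] F) : E →ₗ[𝕜] F).HasFiniteRange →
        IsIntoIso S → ((T - γ t : E →L[𝕜] F) : E →ₗ[𝕜] F).HasFiniteRange → IsIntoIso T →
        Homotopic S T := fun t S T hS hS' hT hT' ↦ by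
      refine homotopic_of_hasFiniteRange hS' (hns t S hS) hT' ?_
      have := hT.sub hS
      rwa [← ContinuousLinearMap.toLinearMap_sub, sub_sub_sub_cancel_right] at this
    -- Second connectedness argument: all into isomorphisms over a given `t` lie in one homotopy
    -- class, so the sets of `t` over `U` and over `V` are disjoint.
    let U := {T : E →L[𝕜] F | Homotopic (γ 0) T}
    let V := {T : E →L[𝕜] F | T ∈ Emb 𝕜 E F ∧ ¬ Homotopic (γ 0) T}
    have hloc : ∀ T ∈ Emb 𝕜 E F, ∀ᶠ S in 𝓝 T, S ∈ Emb 𝕜 E F ∧ Homotopic T S := fun T hT ↦ by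
      let : NormedSpace ℝ (E →L[𝕜] F) := NormedSpace.restrictScalars ℝ 𝕜 _
      obtain ⟨ε, hε, hball⟩ := Metric.isOpen_iff.1 isOpen_emb T hT
      filter_upwards [Metric.ball_mem_nhds T hε] with S hS
      exact ⟨hball hS, (((convex_ball T ε).isPathConnected ⟨T, Metric.mem_ball_self hε⟩).joinedIn T
        (Metric.mem_ball_self hε) S hS).mono hball⟩
    have hU : IsOpen U := isOpen_iff_mem_nhds.2 fun T hT ↦ by
      filter_upwards [hloc T hT.target_mem] with S hS using hT.trans hS.2
    have hV : IsOpen V := isOpen_iff_mem_nhds.2 fun T hT ↦ by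
      filter_upwards [hloc T hT.1] with S hS using ⟨hS.1, fun h ↦ hT.2 (h.trans hS.2.symm)⟩
    have hdisj : Disjoint (γ ⁻¹' {A | ∃ T, ((T - A : E →L[𝕜] F) : E →ₗ[𝕜] F).HasFiniteRange ∧ T ∈ U})
        (γ ⁻¹' {A | ∃ T, ((T - A : E →L[𝕜] F) : E →ₗ[𝕜] F).HasFiniteRange ∧ T ∈ V}) := by
      refine Set.disjoint_left.2 fun t ⟨T, hT, hT'⟩ ⟨S, hS, hS'⟩ ↦ hS'.2 ?_
      exact JoinedIn.trans hT' (hjoin t T S hT hT'.target_mem hS hS'.1)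
    rcases isPreconnected_univ.subset_or_subset
      ((isOpen_setOf_exists_hasFiniteRange hU).preimage hγ)
      ((isOpen_setOf_exists_hasFiniteRange hV).preimage hγ) hdisj (fun t _ ↦ by
        obtain ⟨T, hT, hT', -⟩ := hall (Set.mem_univ t)
        by_cases hTU : T ∈ U
        · exact .inl ⟨T, hT, hTU⟩
        · exact .inr ⟨T, hT, hT', hTU⟩) with hall' | hall'
    · obtain ⟨T, hT, hT'⟩ := hall' (Set.mem_univ 1)
      exact JoinedIn.trans hT' (hjoin 1 T (γ 1) hT hT'.target_mem (hfr0 _) h1)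
    · obtain ⟨T, hT, hT'⟩ := hall' (Set.mem_univ 0)
      exact (hT'.2 (hjoin 0 (γ 0) T (hfr0 _) h0 hT hT'.1)).elim
  · left
    have : ∀ t, IsIntoIso (γ t) → Function.Surjective (γ t) := fun t ht ↦ by
      by_contra hns
      exact HasNegativeIndex.not_hasNonnegativeIndex ⟨γ t, hfr0 _, ht, hns⟩
        (hall (Set.mem_univ t))
    exact ⟨this 0 h0, this 1 h1⟩

/-! ### Operators that are not upper semi-Fredholm. -/

/-- The coefficients of a finite linear combination of a normalized sequence that has
a normalized sequence of functionals, triangular with respect to it. -/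
theorem norm_coeff_le {x : ℕ → E} {f : ℕ → StrongDual 𝕜 E} (hx : ∀ n, ‖x n‖ ≤ 1)
    (hf : ∀ n, ‖f n‖ ≤ 1) (hfx : ∀ n, f n (x n) = 1) (htri : ∀ m n, m < n → f m (x n) = 0)
    (a : ℕ → 𝕜) {N n : ℕ} (hn : n < N) :
    ‖a n‖ ≤ 2 ^ n * ‖∑ k ∈ Finset.range N, a k • x k‖ := by
  set y := ∑ k ∈ Finset.range N, a k • x k with hy
  induction n using Nat.strong_induction_on with
  | _ n ih =>
    have hsum : f n y = ∑ k ∈ Finset.range n, a k * f n (x k) + a n := by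
      have h1 : f n y = ∑ k ∈ Finset.range N, a k * f n (x k) := by simp [hy]
      rw [h1, ← Finset.sum_subset (Finset.range_mono (Nat.succ_le_of_lt hn)), Finset.sum_range_succ,
        hfx, mul_one]
      intro k _ hk
      rw [htri n k (by simpa using hk), mul_zero]
    have hterm : ∀ k ∈ Finset.range n, ‖a k * f n (x k)‖ ≤ 2 ^ k * ‖y‖ := fun k hk ↦ by
      have hk := Finset.mem_range.1 hk
      rw [norm_mul]
      refine (mul_le_of_le_one_right (norm_nonneg _) ?_).trans (ih k hk (hk.trans hn))
      exact (f n).le_of_opNorm_le_of_le (hf n) (hx k) |>.trans_eq (one_mul 1)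
    have hle : ‖f n y‖ ≤ ‖y‖ := ((f n).le_of_opNorm_le (hf n) y).trans_eq (one_mul _)
    have hgeom : ∑ k ∈ Finset.range n, (2 : ℝ) ^ k * ‖y‖ = (2 ^ n - 1) * ‖y‖ := by
      rw [← Finset.sum_mul, geom_sum_eq (by norm_num)]
      norm_num
    calc ‖a n‖ = ‖f n y - ∑ k ∈ Finset.range n, a k * f n (x k)‖ := by
          rw [hsum, add_sub_cancel_left]
      _ ≤ ‖f n y‖ + ∑ k ∈ Finset.range n, ‖a k * f n (x k)‖ :=
          (norm_sub_le _ _).trans (by gcongr; exact norm_sum_le _ _)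
      _ ≤ ‖y‖ + ∑ k ∈ Finset.range n, 2 ^ k * ‖y‖ := by
          gcongr with k hk
          exact hterm k hk
      _ = 2 ^ n * ‖y‖ := by rw [hgeom]; ring

/-- Each vector is chosen in the common kernel of the earlier functionals, where `A` is not bounded
below, and then gets its own norming functional. The natural number carried in the recursion records
the required smallness. -/
theorem exists_triangular_seq {A : E →L[𝕜] F} (hA : ¬ IsUpperSemiFredholm A) {ε : ℝ}
    (hε : 0 < ε) : ∃ (x : ℕ → E) (f : ℕ → StrongDual 𝕜 E), (∀ n, ‖x n‖ ≤ 1) ∧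
      (∀ n, ‖f n‖ ≤ 1) ∧ (∀ n, f n (x n) = 1) ∧ (∀ m n, m < n → f m (x n) = 0) ∧
      ∀ n, ‖A (x n)‖ ≤ ε * (1 / 4) ^ n := by
  classical
  obtain ⟨p, hp, hr⟩ := exists_seq_of_forall_finset_exists (α := ℕ × E × StrongDual 𝕜 E)
    (fun p ↦ ‖p.2.1‖ ≤ 1 ∧ ‖p.2.2‖ ≤ 1 ∧ p.2.2 p.2.1 = 1 ∧ ‖A p.2.1‖ ≤ ε * (1 / 4) ^ p.1)
    (fun p q ↦ p.1 < q.1 ∧ p.2.2 q.2.1 = 0) fun s _ ↦ by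
      set n := s.sup Prod.fst + 1 with hn
      simp only [IsUpperSemiFredholm, not_exists, not_and, not_forall, not_le] at hA
      obtain ⟨x, hx, hAx⟩ := hA (s.image fun p ↦ p.2.2) (ε * (1 / 4) ^ n) (by positivity)
      have hx0 : 0 < ‖x‖ := by
        refine (norm_nonneg x).lt_of_ne fun h0 ↦ ?_
        rw [← h0, mul_zero] at hAx
        exact hAx.not_ge (norm_nonneg _)
      set y : E := ((‖x‖⁻¹ : ℝ) : 𝕜) • x with hy
      have hynorm : ‖y‖ = 1 := by
        rw [hy, norm_smul, RCLike.norm_ofReal, abs_of_pos (inv_pos.2 hx0),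
          inv_mul_cancel₀ hx0.ne']
      obtain ⟨f, hf, hfy⟩ := exists_dual_vector'' 𝕜 y
      refine ⟨(n, y, f), ⟨hynorm.le, hf, by simp [hfy, hynorm], ?_⟩, fun q hq ↦ ⟨?_, ?_⟩⟩
      · change ‖A y‖ ≤ _
        rw [hy, map_smul, norm_smul, RCLike.norm_ofReal, abs_of_pos (inv_pos.2 hx0),
          inv_mul_le_iff₀ hx0, mul_comm ‖x‖]
        exact hAx.le
      · exact Nat.lt_succ_of_le (Finset.le_sup (f := Prod.fst) hq)
      · change q.2.2 y = 0
        rw [hy, map_smul, hx _ (Finset.mem_image_of_mem _ hq), smul_zero]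
  have hmono : StrictMono fun n ↦ (p n).1 := fun m n hmn ↦ (hr m n hmn).1
  refine ⟨fun n ↦ (p n).2.1, fun n ↦ (p n).2.2, fun n ↦ (hp n).1, fun n ↦ (hp n).2.1,
    fun n ↦ (hp n).2.2.1, fun m n hmn ↦ (hr m n hmn).2, fun n ↦ (hp n).2.2.2.trans ?_⟩
  gcongr ε * ?_
  exact pow_le_pow_of_le_one (by norm_num) (by norm_num) hmono.le_apply

/-- An operator that is not upper semi-Fredholm has arbitrarily small norm on some closed
infinite-dimensional subspace. -/
theorem exists_isSubspace_norm_le {A : E →L[𝕜] F} (hA : ¬ IsUpperSemiFredholm A) {ε : ℝ}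
    (hε : 0 < ε) : ∃ U : Submodule 𝕜 E, IsSubspace U ∧ ∀ u ∈ U, ‖A u‖ ≤ ε * ‖u‖ := by
  obtain ⟨x, f, hx, hf, hfx, htri, hAx⟩ := exists_triangular_seq hA (half_pos hε)
  have hrange : ∀ c : ℕ →₀ 𝕜, ∃ N, (∀ n ∈ c.support, n < N) ∧
      (c.sum fun i a ↦ a • x i) = ∑ k ∈ Finset.range N, c k • x k := fun c ↦ by
    refine ⟨c.support.sup id + 1, fun n hn ↦ Nat.lt_succ_of_le (Finset.le_sup (f := id) hn), ?_⟩
    refine Finsupp.sum_of_support_subset _ (fun n hn ↦ ?_) _ (by simp)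
    exact Finset.mem_range.2 (Nat.lt_succ_of_le (Finset.le_sup (f := id) hn))
  set U := (Submodule.span 𝕜 (Set.range x)).topologicalClosure with hU
  refine ⟨U, ⟨Submodule.isClosed_topologicalClosure _, fun hfin ↦ ?_⟩, ?_⟩
  · have hli : LinearIndependent 𝕜 x := by
      refine linearIndependent_iff.2 fun c hc ↦ ?_
      obtain ⟨N, hN, hsum⟩ := hrange c
      rw [Finsupp.linearCombination_apply, hsum] at hc
      ext n
      by_contra hn
      have := norm_coeff_le hx hf hfx htri c (hN n (Finsupp.mem_support_iff.2 hn))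
      rw [hc, norm_zero, mul_zero] at this
      exact hn (norm_le_zero_iff.1 this)
    have hxU : ∀ n, x n ∈ U := fun n ↦
      Submodule.le_topologicalClosure _ (Submodule.subset_span ⟨n, rfl⟩)
    have hli' : LinearIndependent 𝕜 fun n ↦ (⟨x n, hxU n⟩ : U) :=
      LinearIndependent.of_comp U.subtype hli
    exact not_finite_iff_infinite.2 inferInstance hli'.finite
  · have hspan : ∀ u ∈ Submodule.span 𝕜 (Set.range x), ‖A u‖ ≤ ε * ‖u‖ := fun u hu ↦ by
      obtain ⟨c, rfl⟩ := Finsupp.mem_span_range_iff_exists_finsupp.1 hu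
      obtain ⟨N, -, hsum⟩ := hrange c
      rw [hsum]
      set y := ∑ k ∈ Finset.range N, c k • x k with hy
      calc ‖A y‖ = ‖∑ k ∈ Finset.range N, c k • A (x k)‖ := by simp [hy]
        _ ≤ ∑ k ∈ Finset.range N, ‖c k • A (x k)‖ := norm_sum_le _ _
        _ ≤ ∑ k ∈ Finset.range N, (1 / 2) ^ k * (ε / 2 * ‖y‖) := by
            refine Finset.sum_le_sum fun k hk ↦ ?_
            rw [norm_smul]
            -- The decay `(1 / 4) ^ k` beats the coefficient growth `2 ^ k`, leaving a geometric
            -- series of sum at most 2; hence `ε / 2` above.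
            calc ‖c k‖ * ‖A (x k)‖ ≤ (2 ^ k * ‖y‖) * (ε / 2 * (1 / 4) ^ k) := by
                  gcongr
                  · exact norm_coeff_le hx hf hfx htri c (Finset.mem_range.1 hk)
                  · exact hAx k
              _ = (2 * (1 / 4)) ^ k * (ε / 2 * ‖y‖) := by rw [mul_pow]; ring
              _ = (1 / 2) ^ k * (ε / 2 * ‖y‖) := by norm_num
        _ ≤ 2 * (ε / 2 * ‖y‖) := by
            rw [← Finset.sum_mul]
            gcongr
            exact sum_geometric_two_le N
        _ = ε * ‖y‖ := by ring
    have hclosed : IsClosed {u : E | ‖A u‖ ≤ ε * ‖u‖} :=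
      isClosed_le (by fun_prop) (by fun_prop)
    exact fun u hu ↦ closure_minimal hspan hclosed hu

theorem IsIntoIso.isUpperSemiFredholm {A : E →L[𝕜] F} (hA : IsIntoIso A) :
    IsUpperSemiFredholm A := by
  obtain ⟨c, hc, h⟩ := hA
  exact ⟨∅, c, hc, fun x _ ↦ h x⟩

theorem IsIntoIso.smul {A : E →L[𝕜] F} (hA : IsIntoIso A) {a : 𝕜} (ha : a ≠ 0) :
    IsIntoIso (a • A) := by
  obtain ⟨c, hc, h⟩ := hA
  refine ⟨‖a‖ * c, mul_pos (norm_pos_iff.2 ha) hc, fun x ↦ ?_⟩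
  rw [smul_apply, norm_smul, mul_assoc]
  gcongr
  exact h x

end Banach

/-! ### Hereditarily indecomposable spaces. -/

section HI

variable {𝕜 : Type*} [RCLike 𝕜] {X : Type*} [NormedAddCommGroup X] [NormedSpace 𝕜 X]

theorem IsSubspace.map_subtype {Y : Submodule 𝕜 X} (hY : IsClosed (Y : Set X))
    {U : Submodule 𝕜 Y} (hU : IsSubspace U) : IsSubspace (U.map Y.subtype) := by
  refine ⟨?_, fun h ↦ hU.2 ?_⟩
  · rw [Submodule.map_coe]
    exact hY.isClosedEmbedding_subtypeVal.isClosedMap _ hU.1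
  · exact (Submodule.equivMapOfInjective Y.subtype Y.injective_subtype U).symm.finiteDimensional

/-- The unit spheres of any two subspaces of a hereditarily indecomposable space are at
distance zero. -/
theorem IsHI.exists_norm_sub_le (hX : IsHI 𝕜 X) {U V : Submodule 𝕜 X} (hU : IsSubspace U)
    (hV : IsSubspace V) {δ : ℝ} (hδ : 0 < δ) :
    ∃ u ∈ U, ∃ v ∈ V, u ≠ 0 ∧ ‖u - v‖ ≤ δ * ‖u‖ := by
  have h := hX.2 U V hU hV
  simp only [InTopologicalDirectSum, IsIntoIso, not_exists, not_and, not_forall, not_le] at h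
  -- The bound `1 / 2` makes `u` comparable to the larger of the two vectors; `δ / 2` absorbs the
  -- resulting factor 2.
  obtain ⟨⟨u, v⟩, huv⟩ := h (min (δ / 2) (1 / 2)) (by positivity)
  have huv : ‖(u + v : X)‖ < min (δ / 2) (1 / 2) * max ‖(u : X)‖ ‖(v : X)‖ := huv
  set m := max ‖(u : X)‖ ‖(v : X)‖ with hm
  have hm0 : 0 ≤ m := (norm_nonneg _).trans (le_max_left _ _)
  have h1 : ‖(u + v : X)‖ < δ / 2 * m := huv.trans_le (by gcongr; exact min_le_left _ _)
  have h2 : ‖(u + v : X)‖ < 1 / 2 * m := huv.trans_le (by gcongr; exact min_le_right _ _)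
  have hmu : m ≤ 2 * ‖(u : X)‖ := by
    have hv : ‖(v : X)‖ ≤ ‖(u + v : X)‖ + ‖(u : X)‖ := by
      simpa using norm_sub_le (u + v : X) u
    rcases max_choice ‖(u : X)‖ ‖(v : X)‖ with hc | hc
    · rw [hm, hc]
      linarith [norm_nonneg (u : X)]
    · have : m = ‖(v : X)‖ := hc
      linarith
  refine ⟨u, u.2, -v, V.neg_mem v.2, fun h0 ↦ ?_, ?_⟩
  · rw [h0, norm_zero, mul_zero] at hmu
    linarith [norm_nonneg (u + v : X)]
  · rw [sub_neg_eq_add]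
    nlinarith

theorem IsHI.not_isIntoIso_add (hX : IsHI 𝕜 X) {Y : Submodule 𝕜 X} (hY : IsClosed (Y : Set X))
    {A B : Y →L[𝕜] X} (hA : ¬ IsUpperSemiFredholm A) (hB : ¬ IsUpperSemiFredholm B) (a b : 𝕜) :
    ¬ IsIntoIso (a • A + b • B) := by
  rintro ⟨c, hc, h⟩
  -- `M` is chosen so that the combination has norm at most `ε * M * ‖u‖` at `u`, and `ε` so that `ε
  -- * M ≤ c / 2`.
  set M := ‖a‖ + ‖b‖ * (2 + ‖B‖) + 1 with hM
  have hM0 : 0 < M := by positivity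
  set ε := min 1 (c / (2 * M)) with hε
  have hε0 : 0 < ε := by positivity
  have hε1 : ε ≤ 1 := min_le_left _ _
  have hεM : ε * (2 * M) ≤ c := (le_div_iff₀ (by positivity)).1 (min_le_right _ _)
  obtain ⟨U, hU, hAU⟩ := exists_isSubspace_norm_le hA hε0
  obtain ⟨V, hV, hBV⟩ := exists_isSubspace_norm_le hB hε0
  obtain ⟨_, ⟨u, hu, rfl⟩, _, ⟨v, hv, rfl⟩, hu0, huv⟩ :=
    hX.exists_norm_sub_le (hU.map_subtype hY) (hV.map_subtype hY) hε0
  have hu0 : 0 < ‖u‖ := norm_pos_iff.2 fun h0 ↦ hu0 (by simp [h0])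
  have huv : ‖u - v‖ ≤ ε * ‖u‖ := huv
  have hvn : ‖v‖ ≤ 2 * ‖u‖ := by
    have : ‖v‖ ≤ ‖u‖ + ‖u - v‖ := by simpa using norm_sub_le u (u - v)
    nlinarith
  have hBu : ‖B u‖ ≤ ε * ((2 + ‖B‖) * ‖u‖) := by
    calc ‖B u‖ = ‖B v + B (u - v)‖ := by rw [← map_add, add_sub_cancel]
      _ ≤ ‖B v‖ + ‖B (u - v)‖ := norm_add_le _ _
      _ ≤ ε * (2 * ‖u‖) + ‖B‖ * (ε * ‖u‖) := by
          gcongr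
          · exact (hBV v hv).trans (by gcongr)
          · exact (B.le_opNorm _).trans (by gcongr)
      _ = ε * ((2 + ‖B‖) * ‖u‖) := by ring
  have hle : c * ‖u‖ ≤ ε * M * ‖u‖ := by
    calc c * ‖u‖ ≤ ‖a • A u + b • B u‖ := h u
      _ ≤ ‖a‖ * ‖A u‖ + ‖b‖ * ‖B u‖ := by
          simpa only [norm_smul] using norm_add_le (a • A u) (b • B u)
      _ ≤ ‖a‖ * (ε * ‖u‖) + ‖b‖ * (ε * ((2 + ‖B‖) * ‖u‖)) := by
          gcongr
          exact hAU u hu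
      _ = ε * (M - 1) * ‖u‖ := by rw [hM]; ring
      _ ≤ ε * M * ‖u‖ := by gcongr; linarith
  have hcle := le_of_mul_le_mul_right hle hu0
  nlinarith [mul_pos hε0 hM0]

/-- The segment from `S` to `T`, or the one from `S` to `-T`, consists of upper semi-Fredholm
operators. -/
theorem IsHI.isUpperSemiFredholm_segment (hX : IsHI 𝕜 X) {Y : Submodule 𝕜 X}
    (hY : IsClosed (Y : Set X)) {S T : Y →L[𝕜] X} (hS : IsIntoIso S) (hT : IsIntoIso T) :
    (∀ t : unitInterval,
      IsUpperSemiFredholm (((1 - t : ℝ) : 𝕜) • S + ((t : ℝ) : 𝕜) • T)) ∨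
    ∀ t : unitInterval,
      IsUpperSemiFredholm (((1 - t : ℝ) : 𝕜) • S + ((t : ℝ) : 𝕜) • -T) := by
  by_contra! h
  obtain ⟨⟨t, ht⟩, ⟨t', ht'⟩⟩ := h
  -- The weights `t'` and `t` cancel the `T` terms.
  have hcomb := hX.not_isIntoIso_add hY ht ht' ((t' : ℝ) : 𝕜) ((t : ℝ) : 𝕜)
  set r : ℝ := t' * (1 - t) + t * (1 - t') with hr
  have heq : ((t' : ℝ) : 𝕜) • (((1 - t : ℝ) : 𝕜) • S + ((t : ℝ) : 𝕜) • T) +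
      ((t : ℝ) : 𝕜) • (((1 - t' : ℝ) : 𝕜) • S + ((t' : ℝ) : 𝕜) • -T) = (r : 𝕜) • S := by
    rw [hr]
    push_cast
    module
  rw [heq] at hcomb
  have hr0 : r = 0 := by
    by_contra h0
    exact hcomb (hS.smul (RCLike.ofReal_ne_zero.2 h0))
  have h1 : 0 ≤ (t' : ℝ) * (1 - t) := mul_nonneg t'.2.1 (sub_nonneg.2 t.2.2)
  have h2 : 0 ≤ (t : ℝ) * (1 - t') := mul_nonneg t.2.1 (sub_nonneg.2 t'.2.2)
  -- Only the ends of the segment can make `r` vanish, and there the operator is `S` or `T` itself.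
  have ht0 : (t : ℝ) = 0 ∨ (t : ℝ) = 1 := by
    by_contra! hne
    have e1 : (t' : ℝ) = 0 := (mul_eq_zero.1 (by linarith)).resolve_right
      (sub_ne_zero.2 hne.2.symm)
    have e2 : (1 - t' : ℝ) = 0 := (mul_eq_zero.1 (by linarith : (t : ℝ) * (1 - t') = 0)).resolve_left
      hne.1
    linarith
  rcases ht0 with ht0 | ht0 <;> rw [ht0] at ht
  · exact ht (by simpa using hS.isUpperSemiFredholm)
  · exact ht (by simpa using hT.isUpperSemiFredholm)

theorem IsHI.homotopic_or_homotopic_neg [CompleteSpace X] (hX : IsHI 𝕜 X) {Y : Submodule 𝕜 X}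
    (hY : IsClosed (Y : Set X)) {S T : Y →L[𝕜] X} (hS : IsIntoIso S) (hT : IsIntoIso T) :
    (Function.Surjective S ∧ Function.Surjective T) ∨ Homotopic S T ∨ Homotopic S (-T) := by
  have : CompleteSpace Y := hY.completeSpace_coe
  have hT' : IsIntoIso (-T) := by simpa using hT.smul (a := (-1 : 𝕜)) (by simp)
  rcases hX.isUpperSemiFredholm_segment hY hS hT with h | h
  · have := homotopic_of_isUpperSemiFredholm (by fun_prop) h (by simpa using hS) (by simpa using hT)
    simp only [Set.Icc.coe_zero, Set.Icc.coe_one, sub_zero, sub_self, RCLike.ofReal_one,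
      RCLike.ofReal_zero, one_smul, zero_smul, add_zero, zero_add] at this
    exact this.imp id .inl
  · have := homotopic_of_isUpperSemiFredholm (by fun_prop) h (by simpa using hS) (by simpa using hT')
    simp only [Set.Icc.coe_zero, Set.Icc.coe_one, sub_zero, sub_self, RCLike.ofReal_one,
      RCLike.ofReal_zero, one_smul, zero_smul, add_zero, zero_add] at this
    refine this.imp (fun h ↦ ⟨h.1, fun y ↦ ?_⟩) .inr
    obtain ⟨x, hx⟩ := h.2 y
    exact ⟨-x, by simpa using hx⟩

end HI

end BanachHI

theorem mainTheorem7 {𝕜 : Type*} [RCLike 𝕜] {X : Type*} [NormedAddCommGroup X]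
    [NormedSpace 𝕜 X] [CompleteSpace X] (hX : BanachHI.IsHI 𝕜 X) (Y Z : Submodule 𝕜 X)
    (hY : BanachHI.IsSubspace Y) (hZ : BanachHI.IsSubspace Z) (hYZ : Nonempty (Y ≃L[𝕜] Z)) :
    ∃ T : Y →L[𝕜] X, T ∈ BanachHI.Emb 𝕜 Y X ∧
      LinearMap.range (T : Y →ₗ[𝕜] X) = Z ∧
      BanachHI.Homotopic T Y.subtypeL := by
  obtain ⟨e⟩ := hYZ
  have hincl : BanachHI.IsIntoIso Y.subtypeL := ⟨1, one_pos, fun x ↦ by simp⟩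
  set φ : Y →L[𝕜] X := Z.subtypeL ∘L (e : Y →L[𝕜] Z) with hφ
  have hφemb : BanachHI.IsIntoIso φ :=
    BanachHI.isIntoIso_of_antilipschitz (e.antilipschitz : AntilipschitzWith _ e)
  have hrange : LinearMap.range (φ : Y →ₗ[𝕜] X) = Z := by
    ext z
    refine ⟨?_, fun hz ↦ ⟨e.symm ⟨z, hz⟩, by simp [hφ]⟩⟩
    rintro ⟨y, rfl⟩
    exact (e y).2
  rcases hX.homotopic_or_homotopic_neg hY.1 hincl hφemb with ⟨hi, hφs⟩ | h | h
  · refine ⟨Y.subtypeL, hincl, ?_, JoinedIn.refl hincl⟩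
    rw [← hrange, LinearMap.range_eq_top.2 hi, LinearMap.range_eq_top.2 hφs]
  · exact ⟨φ, hφemb, hrange, h.symm⟩
  · refine ⟨-φ, h.target_mem, ?_, h.symm⟩
    rw [ContinuousLinearMap.toLinearMap_neg, LinearMap.range_neg, hrange]
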